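/- Let $G$ be a finite group, and let $\mathrm{Irr}(G)$ denote the set of its complex irreducible characters. For subgroups $A,H\le G$ with $H$ normal, put $C=C_H(A)$ and $D=[H,A]$, and say that $(A,H)$ satisfies $(\ast)$ if $G=AH$, $A>1$ is cyclic, $H=CD$, $C$ is abelian, $D$ is normal in $G$, $C\cap D=1$, and the conjugation action of $A$ on $D$ is Frobenius (that is, $a d a^{-1}\ne d$ for all $1\ne a\in A$ and $1\ne d\in D$). **Theorem 3.2.** Let $p$ be a prime. Then $\chi(xy)=\chi(x)\chi(y)$ for every nonidentity $p$-element $x\in G$, every nonidentity $p'$-element $y\in G$ of prime power order and every $\chi\in\mathrm{Irr}(G)$ if and only if $G$ is a $p$-group, or $G$ is a $p'$-group, or $G$ is abelian, or there are a cyclic subgroup $A>1$ of $G$ and a subgroup $H$ which is either a normal Sylow $p$-subgroup or a normal Hall $p'$-subgroup of $G$ such that $(A,H)$ satisfies $(\ast)$. **Theorem C.** Moreover, $\chi(xy)=\chi(x)\chi(y)$ for all nonidentity elements $x,y\in G$ of prime power order with $(o(x),o(y))=1$ and every $\chi\in\mathrm{Irr}(G)$ if and only if $G$ has prime power order, or $G$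 is abelian, or for some prime $q$ there are a cyclic $q'$-subgroup $A>1$ and a normal Sylow $q$-subgroup $P$ of $G$ such that $(A,P)$ satisfies $(\ast)$. -/

import Mathlib

open scoped Pointwise

/-- `Irr(G)`: the set of complex irreducible characters of `G`, i.e. the trace functions of the
irreducible finite-dimensional complex representations (all of which are, up to isomorphism,
representations on some `ℂⁿ`). Irreducible representations are nonzero by definition. -/
def IrrChar (G : Type*) [Group G] : Set (G → ℂ) :=
  {χ | ∃ (n : ℕ) (ρ : Representation ℂ G (Fin n → ℂ)), ρ.IsIrreducible ∧ ρ.character = χ}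

/-- `x` is a `p`-element: its order is a power of `p` (the identity is allowed). -/
def IsPElement (p : ℕ) {G : Type*} [Group G] (x : G) : Prop :=
  ∃ k : ℕ, orderOf x = p ^ k

/-- `x` has prime power order: its order is `q ^ k` for a prime `q` and `k ≥ 0`
(the identity is allowed). -/
def HasPrimePowerOrder {G : Type*} [Group G] (x : G) : Prop :=
  ∃ q k : ℕ, q.Prime ∧ orderOf x = q ^ k

/-- `x` is a `p'`-element: its order is not divisible by the prime `p`. -/
def IsPPrimeElement (p : ℕ) {G : Type*} [Group G] (x : G) : Prop :=
  ¬ p ∣ orderOf x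

/-- `H` is a `p'`-group: its order is not divisible by the prime `p`. -/
def IsPPrimeGroup (p : ℕ) (H : Type*) [Group H] : Prop :=
  ¬ p ∣ Nat.card H

/-- `H` is a Sylow `p`-subgroup of the finite group `G`: its order is a power of `p`
and its index is prime to `p`. -/
def IsSylowSubgroup (p : ℕ) {G : Type*} [Group G] (H : Subgroup G) : Prop :=
  IsPGroup p H ∧ ¬ p ∣ H.index

/-- `H` is a Hall `p'`-subgroup of the finite group `G`: its order is prime to `p`
and its index is a power of `p`. -/
def IsHallPPrimeSubgroup (p : ℕ) {G : Type*} [Group G] (H : Subgroup G) : Prop :=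
  IsPPrimeGroup p H ∧ ∃ k : ℕ, H.index = p ^ k

/-- `A` normalizes `D` and its conjugation action on `D` is Frobenius: no nonidentity element of
`A` fixes a nonidentity element of `D`. -/
def IsFrobeniusAction {G : Type*} [Group G] (A D : Subgroup G) : Prop :=
  A ≤ Subgroup.normalizer (D : Set G) ∧ ∀ a ∈ A, a ≠ 1 → ∀ d ∈ D, d ≠ 1 → a * d * a⁻¹ ≠ d

/-- `C_H(A)`: the elements of `H` that commute with every element of `A`. -/
def centralizerIn {G : Type*} [Group G] (H A : Subgroup G) : Subgroup G :=
  H ⊓ Subgroup.centralizer (A : Set G)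

/-- The structure shared by both classifications: `G = AH` with `A > 1` cyclic and `H` normal;
for `C = C_H(A)` and `D = [H, A]` one has `H = CD`, `C` is abelian, `D` is normal in `G` and
`C ∩ D = 1`; and `A` acts Frobeniusly on `D`. -/
structure HasFrobeniusStructure {G : Type*} [Group G] (A H : Subgroup G) : Prop where
  eq_mul : (A : Set G) * (H : Set G) = Set.univ
  ne_bot : A ≠ ⊥
  isCyclic : IsCyclic A
  normal : H.Normal
  eq_CD : (centralizerIn H A : Set G) * ((⁅H, A⁆ : Subgroup G) : Set G) = (H : Set G)
  abelian_C : ∀ x ∈ centralizerIn H A, ∀ y ∈ centralizerIn H A, x * y = y * x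
  normal_D : (⁅H, A⁆ : Subgroup G).Normal
  inf_CD : centralizerIn H A ⊓ ⁅H, A⁆ = ⊥
  frobenius : IsFrobeniusAction A ⁅H, A⁆

/-!
Call `z` anticentral if its conjugacy class is the coset `z G'`. By Schur's lemma and column
orthogonality this happens exactly when every nonlinear irreducible character vanishes at `z`.

If a nonlinear `χ` is multiplicative on the pairs `(x, y^g)`, then averaging `χ(x y^g)` over `g`
gives `χ(x) χ(y) = χ(1) χ(x) χ(y)`, so `χ` vanishes at `x` or at `y`. A character vanishing at all
nonidentity elements of prime power order dividing `m` has degree divisible by `m`; as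
`χ(1)² ≤ |G|`, and one of `|G|_p`, `|G|_{p'}` exceeds `√|G|`, either all nonidentity `p`-elements or
all nonidentity `p'`-elements of prime power order are anticentral.

If all elements of order `q` are anticentral, then `q ∤ |G'|` and they act on `G'` without fixed
points. So there is a normal Hall subgroup containing `G'` whose complement `A` is abelian and acts
on `G'` without fixed points; such an `A` is cyclic, and `G = C_G(A) G'`. Conversely, a Frobenius
structure makes every element outside `H` anticentral.
-/

theorem commutator_le_ker_iff {G M : Type*} [Group G] [Monoid M] (f : G →* M) :
    commutator G ≤ f.ker ↔ ∀ g h, Commute (f g) (f h) := by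
  rw [commutator_def, Subgroup.commutator_le]
  simp only [Subgroup.mem_top, forall_const]
  refine forall₂_congr fun g h ↦ ?_
  rw [commutatorElement_def, mul_assoc, ← mul_inv_rev, ← div_eq_mul_inv,
    MonoidHom.div_mem_ker_iff, map_mul, map_mul, commute_iff_eq]

section ConjSum

open MonoidAlgebra

variable (k : Type*) {G : Type*} [Semiring k] [Group G] [Fintype G]

/-- The sum of all conjugates of `z` by elements of `G`, that is `|C_G(z)|` times the sum of the
conjugacy class of `z`. Unlike the class sum it is indexed by `G` itself. -/
noncomputable def conjSum (z : G) : MonoidAlgebra k G :=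
  ∑ g : G, of k G (g * z * g⁻¹)

variable {k}

theorem of_mul_conjSum (h z : G) :
    of k G h * conjSum k z = conjSum k z * of k G h := by
  simp only [conjSum, Finset.mul_sum, Finset.sum_mul, ← map_mul]
  exact Fintype.sum_equiv (Equiv.mulLeft h) _ _ fun g ↦ by simp [mul_assoc]

theorem isConj_of_conjSum_mul_of_eq [CharZero k] {z e : G}
    (h : conjSum k z * of k G e = conjSum k z) : IsConj z (z * e) := by
  classical
  have hcoeff (w : G) : (conjSum k z).coeff w = Finset.card {g : G | g * z * g⁻¹ = w} := by
    simp [conjSum, Finsupp.single_apply]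
  have hcard := congr(MonoidAlgebra.coeff $h (z * e))
  rw [of_apply, coeff_mul_single_apply, mul_inv_cancel_right, mul_one, hcoeff, hcoeff,
    Nat.cast_inj] at hcard
  have hpos : 0 < Finset.card {g : G | g * z * g⁻¹ = z} :=
    Finset.card_pos.2 ⟨1, by simp⟩
  obtain ⟨g, hg⟩ := Finset.card_pos.1 (hcard ▸ hpos)
  exact isConj_iff.2 ⟨g, by simpa using hg⟩

end ConjSum

section Representation

open Module MonoidAlgebra

variable {k G V : Type*} [Field k] [Group G] [AddCommGroup V] [Module k V]
  {ρ : Representation k G V}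

theorem nontrivial_of_isIrreducible (_ : ρ.IsIrreducible) : Nontrivial V :=
  have := IsSimpleModule.nontrivial (MonoidAlgebra k G) ρ.asModule
  ρ.asModuleEquiv.symm.toEquiv.nontrivial

theorem isIrreducible_of_asAlgebraHom_surjective [Nontrivial V]
    (h : Function.Surjective ρ.asAlgebraHom) : ρ.IsIrreducible := by
  rw [Representation.irreducible_iff_isSimpleModule_asModule,
    isSimpleModule_iff_toSpanSingleton_surjective]
  refine ⟨ρ.asModuleEquiv.toEquiv.nontrivial, fun v hv w ↦ ?_⟩
  have hv' : ρ.asModuleEquiv v ≠ 0 := by simpa using hv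
  obtain ⟨T, hT⟩ :=
    IsSimpleModule.toSpanSingleton_surjective (End k V) hv' (ρ.asModuleEquiv w)
  obtain ⟨a, rfl⟩ := h T
  exact ⟨a, ρ.asModuleEquiv.injective <| by simpa using hT⟩

variable [FiniteDimensional k V]

theorem character_mul_of_finrank_eq_one (h : finrank k V = 1) (x y : G) :
    ρ.character (x * y) = ρ.character x * ρ.character y := by
  obtain ⟨c, hc, -⟩ := LinearMap.existsUnique_eq_smul_id_of_finrank_eq_one h (ρ x)
  simp [Representation.character, hc, h, End.mul_eq_comp]

variable [IsAlgClosed k]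

theorem asAlgebraHom_surjective_of_isIrreducible (hρ : ρ.IsIrreducible) :
    Function.Surjective ρ.asAlgebraHom := by
  intro T
  have hscalar := (IsSimpleModule.algebraMap_end_bijective_of_isAlgClosed k
    (A := MonoidAlgebra k G) (V := ρ.asModule)).2
  let T' : End (End (MonoidAlgebra k G) ρ.asModule) ρ.asModule :=
    { toFun := fun v ↦ ρ.asModuleEquiv.symm (T (ρ.asModuleEquiv v))
      map_add' := by simp
      map_smul' := fun f v ↦ by
        obtain ⟨c, rfl⟩ := hscalar f
        simp }
  have : Module.Finite (End (MonoidAlgebra k G) ρ.asModule) ρ.asModule :=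
    .of_restrictScalars_finite k _ _
  obtain ⟨a, ha⟩ := Module.Finite.toModuleEnd_moduleEnd_surjective T'
  refine ⟨a, LinearMap.ext fun v ↦ ?_⟩
  have := congr(ρ.asModuleEquiv ($ha (ρ.asModuleEquiv.symm v)))
  simpa [T'] using this

theorem sq_finrank_le_card [Finite G] (hρ : ρ.IsIrreducible) : finrank k V ^ 2 ≤ Nat.card G := by
  calc finrank k V ^ 2 = finrank k (End k V) := by rw [sq, finrank_linearMap]
    _ ≤ finrank k (MonoidAlgebra k G) :=
      LinearMap.finrank_le_finrank_of_surjective (f := ρ.asAlgebraHom.toLinearMap)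
        (asAlgebraHom_surjective_of_isIrreducible hρ)
    _ = Nat.card G := finrank_eq_nat_card_basis (MonoidAlgebra.basis G k)

theorem exists_eq_smul_one_of_forall_commute (hρ : ρ.IsIrreducible) {T : End k V}
    (hT : ∀ g, Commute T (ρ g)) : ∃ c : k, T = c • 1 := by
  obtain ⟨c, hc⟩ :=
    Representation.IsIrreducible.algebraMap_intertwiningMap_bijective_of_isAlgClosed.2
      (⟨T, hT⟩ : Representation.IntertwiningMap ρ ρ)
  refine ⟨c, ?_⟩
  rw [Algebra.algebraMap_eq_smul_one] at hc
  exact congr(Representation.IntertwiningMap.toLinearMap $hc).symm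

theorem finrank_eq_one_iff_commutator_le_ker (hρ : ρ.IsIrreducible) :
    finrank k V = 1 ↔ commutator G ≤ MonoidHom.ker ρ := by
  rw [commutator_le_ker_iff]
  constructor
  · intro h g h'
    obtain ⟨c, hc, -⟩ := LinearMap.existsUnique_eq_smul_id_of_finrank_eq_one h (ρ g)
    rw [hc]
    exact (Commute.one_left _).smul_left c
  · intro hcomm
    have hcomm_all (T : End k V) (g : G) : Commute T (ρ g) := by
      obtain ⟨a, rfl⟩ := asAlgebraHom_surjective_of_isIrreducible hρ T
      induction a using MonoidAlgebra.induction_on with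
      | of h => simpa using hcomm h g
      | add a b ha hb => simpa using ha.add_left hb
      | smul c a ha => simpa using ha.smul_left c
    have hEnd : finrank k (End k V) ≤ 1 := finrank_le_one 1 fun T ↦ by
      obtain ⟨c, hc⟩ := exists_eq_smul_one_of_forall_commute hρ (hcomm_all T)
      exact ⟨c, hc.symm⟩
    have := nontrivial_of_isIrreducible hρ
    rw [finrank_linearMap] at hEnd
    have := finrank_pos (R := k) (M := V)
    nlinarith

theorem eq_zero_of_forall_asAlgebraHom_eq_zero [Finite G] [NeZero (Nat.card G : k)]
    {a : MonoidAlgebra k G}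
    (ha : ∀ (n : ℕ) (ρ : Representation k G (Fin n → k)), ρ.IsIrreducible → ρ.asAlgebraHom a = 0) :
    a = 0 := by
  obtain ⟨m, d, _, ⟨φ⟩⟩ :=
    IsSemisimpleRing.exists_algEquiv_pi_matrix_of_isAlgClosed k (MonoidAlgebra k G)
  refine φ.injective <| funext fun i ↦ ?_
  let ψ : MonoidAlgebra k G →ₐ[k] Module.End k (Fin (d i) → k) :=
    Matrix.toLinAlgEquiv'.toAlgHom.comp <|
      (Pi.evalAlgHom k (fun i ↦ Matrix (Fin (d i)) (Fin (d i)) k) i).comp φ.toAlgHom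
  have hψ : Representation.asAlgebraHom ((MonoidAlgebra.lift k _ G).symm ψ) = ψ :=
    (MonoidAlgebra.lift k _ G).apply_symm_apply ψ
  have hirr := isIrreducible_of_asAlgebraHom_surjective
    (ρ := (MonoidAlgebra.lift k (Module.End k (Fin (d i) → k)) G).symm ψ) <| by
      rw [hψ]
      exact Matrix.toLinAlgEquiv'.surjective.comp <|
        (Function.surjective_eval i).comp φ.surjective
  have := ha _ _ hirr
  rw [hψ] at this
  simpa [ψ] using this

variable [Fintype G]

theorem finrank_smul_asAlgebraHom_conjSum (hρ : ρ.IsIrreducible) (z : G) :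
    (finrank k V : k) • ρ.asAlgebraHom (conjSum k z) = (Fintype.card G * ρ.character z) • 1 := by
  obtain ⟨c, hc⟩ := exists_eq_smul_one_of_forall_commute hρ
    (T := ρ.asAlgebraHom (conjSum k z)) fun g ↦ by
      rw [← ρ.asAlgebraHom_of, commute_iff_eq, ← map_mul, ← map_mul, of_mul_conjSum]
  have htrace := congr(LinearMap.trace k V $hc)
  simp only [conjSum, map_sum, Representation.asAlgebraHom_of] at htrace
  change ∑ g, ρ.character (g * z * g⁻¹) = _ at htrace
  simp only [Representation.char_conj, Finset.sum_const, Finset.card_univ, nsmul_eq_mul, map_smul,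
    LinearMap.trace_one, smul_eq_mul] at htrace
  rw [hc, htrace, smul_smul, mul_comm]

theorem finrank_mul_sum_character_mul_conj (hρ : ρ.IsIrreducible) (x y : G) :
    finrank k V * ∑ g, ρ.character (x * (g * y * g⁻¹)) =
      Fintype.card G * ρ.character x * ρ.character y := by
  have htrace := congr(LinearMap.trace k V (ρ x * $(finrank_smul_asAlgebraHom_conjSum hρ y)))
  simp only [conjSum, map_sum, Representation.asAlgebraHom_of, mul_smul_comm, Finset.mul_sum,
    ← map_mul, map_smul, smul_eq_mul, mul_one] at htrace
  simp only [Representation.character, Finset.mul_sum, htrace]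
  ring

end Representation

/-- `z` is anticentral: its conjugacy class is the whole coset `z G'` of the derived subgroup. -/
def IsAnticentral {G : Type*} [Group G] (z : G) : Prop :=
  ∀ e ∈ commutator G, IsConj z (z * e)

section CharZero

open Module MonoidAlgebra

variable {k G V : Type*} [Field k] [CharZero k] [Group G] [AddCommGroup V] [Module k V]
  [FiniteDimensional k V] {ρ : Representation k G V}

theorem le_ker_of_forall_character_eq_finrank (N : Subgroup G) [Finite N]
    (hN : ∀ e ∈ N, ρ.character e = finrank k V) : N ≤ MonoidHom.ker ρ := by
  have : Fintype N := Fintype.ofFinite N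
  have hcard : (Fintype.card N : k) ≠ 0 := by simp
  have : Invertible (Nat.card N : k) := invertibleOfNonzero (by simp)
  have hdim := Representation.card_inv_mul_sum_char_eq_finrank (ρ.comp N.subtype)
  have hsum (e : N) : Representation.character (ρ.comp N.subtype) e = finrank k V :=
    hN e e.2
  simp only [hsum, Finset.sum_const, Finset.card_univ, nsmul_eq_mul, Nat.card_eq_fintype_card,
    inv_mul_cancel_left₀ hcard, Nat.cast_inj] at hdim
  intro e he
  refine MonoidHom.mem_ker.2 <| LinearMap.ext fun v ↦ ?_
  have hv : v ∈ Representation.invariants (ρ.comp N.subtype) :=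
    Submodule.eq_top_of_finrank_eq hdim.symm ▸ Submodule.mem_top
  exact hv ⟨e, he⟩

theorem card_dvd_finrank_of_character_eq_zero (Q : Subgroup G) [Finite Q]
    (hQ : ∀ x ∈ Q, x ≠ 1 → ρ.character x = 0) : Nat.card Q ∣ finrank k V := by
  have : Fintype Q := Fintype.ofFinite Q
  have hcard : (Nat.card Q : k) ≠ 0 := by simp
  have : Invertible (Nat.card Q : k) := invertibleOfNonzero hcard
  have hzero (g : Q) (hg : g ≠ 1) : Representation.character (ρ.comp Q.subtype) g = 0 :=
    hQ g g.2 (by simpa using hg)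
  have hsum : ∑ g : Q, Representation.character (ρ.comp Q.subtype) g = finrank k V := by
    rw [Fintype.sum_eq_single 1 hzero, Representation.char_one]
  have h := Representation.card_inv_mul_sum_char_eq_finrank (ρ.comp Q.subtype)
  rw [hsum, inv_mul_eq_iff_eq_mul₀ hcard] at h
  exact ⟨_, by exact_mod_cast h⟩

theorem dvd_finrank_of_character_eq_zero [Finite G] {m : ℕ} (hm : m ∣ Nat.card G)
    (h : ∀ x : G, x ≠ 1 → HasPrimePowerOrder x → orderOf x ∣ m → ρ.character x = 0) :
    m ∣ finrank k V := by
  refine Nat.dvd_iff_prime_pow_dvd_dvd _ _ |>.2 fun q i hq hqi ↦ ?_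
  have : Fact q.Prime := ⟨hq⟩
  obtain ⟨Q, hQ⟩ := Sylow.exists_subgroup_card_pow_prime q (hqi.trans hm)
  rw [← hQ]
  refine card_dvd_finrank_of_character_eq_zero (ρ := ρ) Q fun x hx hx1 ↦ ?_
  have hord : orderOf x ∣ q ^ i := hQ ▸ Q.orderOf_dvd_natCard hx
  obtain ⟨j, -, hj⟩ := (Nat.dvd_prime_pow hq).1 hord
  exact h x hx1 ⟨q, j, hq, hj⟩ (hord.trans hqi)

variable [IsAlgClosed k]

theorem IsAnticentral.character_eq_zero [Finite G] {z : G} (hz : IsAnticentral z)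
    (hρ : ρ.IsIrreducible) (hdeg : finrank k V ≠ 1) : ρ.character z = 0 := by
  contrapose! hdeg
  have : Fintype G := Fintype.ofFinite G
  rw [finrank_eq_one_iff_commutator_le_ker hρ]
  refine le_ker_of_forall_character_eq_finrank _ fun e he ↦ ?_
  have hconst (g : G) : ρ.character (z * (g * e * g⁻¹)) = ρ.character z := by
    obtain ⟨c, hc⟩ :=
      isConj_iff.1 (hz _ ((inferInstance : (commutator G).Normal).conj_mem e he g))
    rw [← hc, Representation.char_conj]
  have h := finrank_mul_sum_character_mul_conj hρ z e
  have hcard : (Fintype.card G : k) ≠ 0 := by simp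
  simp only [hconst, Finset.sum_const, Finset.card_univ, nsmul_eq_mul] at h
  exact mul_left_cancel₀ (mul_ne_zero hcard hdeg) (by rw [← h]; ring)

theorem isAnticentral_of_forall_character_eq_zero [Finite G] {z : G}
    (hz : ∀ (n : ℕ) (ρ : Representation k G (Fin n → k)),
      ρ.IsIrreducible → n ≠ 1 → ρ.character z = 0) : IsAnticentral z := by
  intro e he
  have : Fintype G := Fintype.ofFinite G
  have : NeZero (Nat.card G : k) := ⟨by simp⟩
  refine isConj_of_conjSum_mul_of_eq (k := k) <| sub_eq_zero.1 <|
    eq_zero_of_forall_asAlgebraHom_eq_zero fun n ρ hρ ↦ ?_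
  have hdeg := finrank_eq_one_iff_commutator_le_ker hρ
  rw [finrank_fin_fun] at hdeg
  rw [map_sub, map_mul, Representation.asAlgebraHom_of]
  by_cases hn : n = 1
  · rw [MonoidHom.mem_ker.1 (hdeg.1 hn he), mul_one, sub_self]
  · have h := finrank_smul_asAlgebraHom_conjSum hρ z
    have hn0 : n ≠ 0 := by
      rintro rfl
      exact not_nontrivial _ (nontrivial_of_isIrreducible hρ)
    rw [hz n ρ hρ hn, mul_zero, zero_smul, smul_eq_zero, finrank_fin_fun, Nat.cast_eq_zero] at h
    rw [h.resolve_left hn0, zero_mul, sub_zero]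

end CharZero

namespace IrrChar

variable {G : Type*} [Group G] {χ : G → ℂ}

theorem mul_of_apply_one_eq_one (hχ : χ ∈ IrrChar G) (h1 : χ 1 = 1) (x y : G) :
    χ (x * y) = χ x * χ y := by
  obtain ⟨n, ρ, -, rfl⟩ := hχ
  exact character_mul_of_finrank_eq_one (by simpa using h1) x y

theorem mul_of_isMulCommutative [IsMulCommutative G] (hχ : χ ∈ IrrChar G) (x y : G) :
    χ (x * y) = χ x * χ y := by
  obtain ⟨n, ρ, hρ, rfl⟩ := hχ
  exact character_mul_of_finrank_eq_one
    (Representation.IsIrreducible.finrank_eq_one_of_isMulCommutative ρ) x y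

variable [Finite G]

theorem isAnticentral_iff {z : G} :
    IsAnticentral z ↔ ∀ χ ∈ IrrChar G, χ 1 ≠ 1 → χ z = 0 := by
  constructor
  · rintro hz χ ⟨n, ρ, hρ, rfl⟩ h1
    exact hz.character_eq_zero hρ (by simpa using h1)
  · exact fun h ↦ isAnticentral_of_forall_character_eq_zero (k := ℂ) fun n ρ hρ hn ↦
      h _ ⟨n, ρ, hρ, rfl⟩ (by simpa using hn)

theorem eq_zero_or_eq_zero_of_forall_conj (hχ : χ ∈ IrrChar G) (h1 : χ 1 ≠ 1) {x y : G}
    (hmul : ∀ g, χ (x * (g * y * g⁻¹)) = χ x * χ y) : χ x = 0 ∨ χ y = 0 := by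
  obtain ⟨n, ρ, hρ, rfl⟩ := hχ
  have : Fintype G := Fintype.ofFinite G
  have h := finrank_mul_sum_character_mul_conj hρ x y
  rw [Representation.char_one, Module.finrank_fin_fun] at h1
  rw [Module.finrank_fin_fun] at h
  simp only [hmul, Finset.sum_const, Finset.card_univ, nsmul_eq_mul] at h
  have h' : Fintype.card G * (n - 1) * (ρ.character x * ρ.character y) = 0 := by
    linear_combination h
  simpa [sub_ne_zero.2 h1] using h'

theorem sq_le_card (hχ : χ ∈ IrrChar G) {m : ℕ} (hm : m ∣ Nat.card G)
    (h : ∀ x, x ≠ 1 → HasPrimePowerOrder x → orderOf x ∣ m → χ x = 0) : m ^ 2 ≤ Nat.card G := by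
  obtain ⟨n, ρ, hρ, rfl⟩ := hχ
  have := nontrivial_of_isIrreducible hρ
  calc m ^ 2 ≤ Module.finrank ℂ (Fin n → ℂ) ^ 2 := by
        gcongr
        exact Nat.le_of_dvd Module.finrank_pos (dvd_finrank_of_character_eq_zero hm h)
    _ ≤ Nat.card G := sq_finrank_le_card hρ

end IrrChar

theorem lt_sq_ordProj_or_lt_sq_ordCompl {p n : ℕ} (hp : p.Prime) (hn : n ≠ 0) (hpn : p ∣ n) :
    n < (ordProj[p] n) ^ 2 ∨ n < (ordCompl[p] n) ^ 2 := by
  have hne : ordProj[p] n ≠ ordCompl[p] n := fun h ↦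
    Nat.not_dvd_ordCompl hp hn <|
      h ▸ dvd_pow_self p (hp.factorization_pos_of_dvd hn hpn).ne'
  have hprod := Nat.ordProj_mul_ordCompl_eq_self n p
  set a := ordProj[p] n
  set b := ordCompl[p] n
  rcases hne.lt_or_gt with hlt | hlt
  · exact .inr (by nlinarith)
  · exact .inl (by nlinarith)

section IsPMultiplicative

variable {G : Type*} [Group G] {p : ℕ}

/-- Every irreducible character of `G` is multiplicative on the products of a nonidentity
`p`-element and a nonidentity `p'`-element of prime power order. -/
def IsPMultiplicative (p : ℕ) (G : Type*) [Group G] : Prop :=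
  ∀ x y : G, x ≠ 1 → y ≠ 1 → IsPElement p x → IsPPrimeElement p y → HasPrimePowerOrder y →
    ∀ χ ∈ IrrChar G, χ (x * y) = χ x * χ y

theorem IsPMultiplicative.eq_zero_or_eq_zero [Finite G] (h : IsPMultiplicative p G)
    {χ : G → ℂ} (hχ : χ ∈ IrrChar G) (h1 : χ 1 ≠ 1) {x y : G} (hx1 : x ≠ 1) (hy1 : y ≠ 1)
    (hx : IsPElement p x) (hy : IsPPrimeElement p y) (hyq : HasPrimePowerOrder y) :
    χ x = 0 ∨ χ y = 0 := by
  refine IrrChar.eq_zero_or_eq_zero_of_forall_conj hχ h1 fun g ↦ ?_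
  have hord : orderOf (g * y * g⁻¹) = orderOf y := (MulAut.conj g).orderOf_eq y
  rw [h x (g * y * g⁻¹) hx1 (by simpa using hy1) hx (by rwa [IsPPrimeElement, hord])
    (by rwa [HasPrimePowerOrder, hord]) χ hχ]
  obtain ⟨n, ρ, -, rfl⟩ := hχ
  rw [Representation.char_conj]

theorem IsPMultiplicative.forall_isAnticentral_or_forall_isAnticentral [Finite G]
    (h : IsPMultiplicative p G) (hp : p.Prime) (hpG : p ∣ Nat.card G) :
    (∀ x : G, x ≠ 1 → IsPElement p x → IsAnticentral x) ∨
      ∀ y : G, y ≠ 1 → IsPPrimeElement p y → HasPrimePowerOrder y → IsAnticentral y := by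
  by_contra! ⟨⟨x, hx1, hx, hxA⟩, y, hy1, hy, hyq, hyA⟩
  rw [IrrChar.isAnticentral_iff] at hxA hyA
  push Not at hxA hyA
  obtain ⟨χ, hχ, hχ1, hχx⟩ := hxA
  obtain ⟨ψ, hψ, hψ1, hψy⟩ := hyA
  have hcard : Nat.card G ≠ 0 := Nat.card_pos.ne'
  have hψ_sq : (ordProj[p] (Nat.card G)) ^ 2 ≤ Nat.card G :=
    IrrChar.sq_le_card hψ (Nat.ordProj_dvd _ _) fun z hz1 _ hz ↦ by
      obtain ⟨i, -, hi⟩ := (Nat.dvd_prime_pow hp).1 hz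
      exact (h.eq_zero_or_eq_zero hψ hψ1 hz1 hy1 ⟨i, hi⟩ hy hyq).resolve_right hψy
  have hχ_sq : (ordCompl[p] (Nat.card G)) ^ 2 ≤ Nat.card G :=
    IrrChar.sq_le_card hχ (Nat.ordCompl_dvd _ _) fun z hz1 hzq hz ↦
      (h.eq_zero_or_eq_zero hχ hχ1 hx1 hz1 hx
        (fun hpz ↦ Nat.not_dvd_ordCompl hp hcard (hpz.trans hz)) hzq).resolve_left hχx
  rcases lt_sq_ordProj_or_lt_sq_ordCompl hp hcard hpG with hlt | hlt
  exacts [hψ_sq.not_gt hlt, hχ_sq.not_gt hlt]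

end IsPMultiplicative

section FrobeniusComplement

open MonoidAlgebra in
theorem isCyclic_of_fixedPointFree_of_commGroup {A V : Type*} [CommGroup A] [Finite A]
    [CommGroup V] [Finite V] [Nontrivial V] [MulDistribMulAction A V]
    (hfix : ∀ g : A, g ≠ 1 → ∀ v : V, g • v = v → v = 1) : IsCyclic A := by
  let ρ := Representation.ofMulDistribMulAction A V
  have : Finite ρ.asModule := inferInstanceAs (Finite (Additive V))
  have : Nontrivial ρ.asModule := inferInstanceAs (Nontrivial (Additive V))
  obtain ⟨S, hS⟩ := IsAtomic.exists_atom (Submodule (MonoidAlgebra ℤ A) ρ.asModule)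
  have : IsSimpleModule (MonoidAlgebra ℤ A) S := isSimpleModule_iff_isAtom.2 hS
  have := IsSimpleModule.nontrivial (MonoidAlgebra ℤ A) S
  obtain ⟨s, hs⟩ := exists_ne (0 : S)
  let I : Ideal (MonoidAlgebra ℤ A) :=
    LinearMap.ker (LinearMap.toSpanSingleton (MonoidAlgebra ℤ A) S s)
  have : I.IsMaximal := IsSimpleModule.ker_toSpanSingleton_isMaximal _ hs
  let f : A →* MonoidAlgebra ℤ A ⧸ I := (Ideal.Quotient.mk I : _ →* _).comp (of ℤ A)
  refine isCyclic_of_injective_ringHom f <| (injective_iff_map_eq_one f).2 fun g hg ↦ ?_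
  by_contra hg1
  have hgs : of ℤ A g • s = s := by
    have : of ℤ A g - 1 ∈ I := (Ideal.Quotient.mk_eq_mk_iff_sub_mem _ _).1 hg
    simpa [I, sub_smul, sub_eq_zero] using this
  have h := congr(ρ.asModuleEquiv ($hgs : S))
  rw [Submodule.coe_smul, Representation.asModuleEquiv_map_smul,
    Representation.asAlgebraHom_of] at h
  exact hs (Subtype.ext <| hfix g hg1 _ h)

open scoped IsMulCommutative in
theorem isCyclic_of_fixedPointFree_of_isMulCommutative {A N : Type*} [CommGroup A] [Finite A]
    [Group N] [Finite N] [MulDistribMulAction A N] (W : Subgroup N) [IsMulCommutative W]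
    (hW : W ≠ ⊥) (hinv : ∀ (g : A), ∀ v ∈ W, g • v ∈ W)
    (hfix : ∀ g : A, g ≠ 1 → ∀ v ∈ W, g • v = v → v = 1) : IsCyclic A := by
  have : Nontrivial W := W.nontrivial_iff_ne_bot.2 hW
  let : SMul A W := ⟨fun g v ↦ ⟨g • v, hinv g v v.2⟩⟩
  let : MulDistribMulAction A W :=
    Function.Injective.mulDistribMulAction W.subtype W.subtype_injective fun _ _ ↦ rfl
  refine isCyclic_of_fixedPointFree_of_commGroup (A := A) (V := W) fun g hg v hv ↦ ?_
  exact Subtype.ext <| hfix g hg v v.2 congr(($hv : N))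

theorem exists_isMulCommutative_of_sylow_mem_fixedPoints {r : ℕ} [Fact r.Prime] {Q N : Type*}
    [Group Q] [Group N] [Finite N] [MulDistribMulAction Q N] (hr : r ∣ Nat.card N) {R : Sylow r N}
    (hR : R ∈ MulAction.fixedPoints Q (Sylow r N)) :
    ∃ W : Subgroup N, IsMulCommutative W ∧ W ≠ ⊥ ∧ ∀ g : Q, ∀ v ∈ W, g • v ∈ W := by
  have hmem (g : Q) {v : N} (hv : v ∈ R) : g • v ∈ R := by
    rw [← hR g]
    exact Subgroup.smul_mem_pointwise_smul v g R.toSubgroup hv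
  have : Nontrivial R := R.toSubgroup.nontrivial_iff_ne_bot.2 (R.ne_bot_of_dvd_card hr)
  have := R.2.center_nontrivial
  refine ⟨(Subgroup.center R).map R.toSubgroup.subtype, inferInstance, ?_, ?_⟩
  · rwa [Ne, Subgroup.map_eq_bot_iff_of_injective _ R.toSubgroup.subtype_injective, ← Ne,
      ← Subgroup.nontrivial_iff_ne_bot]
  · rintro g _ ⟨v, hv, rfl⟩
    refine ⟨⟨g • (v : N), hmem g v.2⟩, Subgroup.mem_center_iff.2 fun w ↦ Subtype.ext ?_, rfl⟩
    have hcomm := Subgroup.mem_center_iff.1 hv ⟨g⁻¹ • (w : N), hmem g⁻¹ w.2⟩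
    simpa using congr(g • ($hcomm : N))

theorem isCyclic_of_isPGroup_of_fixedPointFree {q : ℕ} [Fact q.Prime] {Q N : Type*} [CommGroup Q]
    [Finite Q] [Group N] [Finite N] [Nontrivial N] [MulDistribMulAction Q N] (hQ : IsPGroup q Q)
    (hfix : ∀ g : Q, g ≠ 1 → ∀ v : N, g • v = v → v = 1) : IsCyclic Q := by
  rcases subsingleton_or_nontrivial Q with _ | _
  · infer_instance
  have hqN : ¬ q ∣ Nat.card N := by
    intro hdvd
    obtain ⟨v, hv, hv1⟩ := hQ.exists_fixed_point_of_prime_dvd_card_of_fixed_point N hdvd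
      (a := 1) fun g ↦ smul_one g
    obtain ⟨g, hg⟩ := exists_ne (1 : Q)
    exact hv1 (hfix g hg v (hv g)).symm
  obtain ⟨r, hr, hrN⟩ := Nat.exists_prime_and_dvd (Finite.one_lt_card (α := N)).ne'
  have : Fact r.Prime := ⟨hr⟩
  have hqSylow : ¬ q ∣ Nat.card (Sylow r N) := fun hdvd ↦ hqN <|
    hdvd.trans <| (default : Sylow r N).card_dvd_index.trans <| Subgroup.index_dvd_card _
  obtain ⟨R, hR⟩ := hQ.nonempty_fixed_point_of_prime_not_dvd_card (Sylow r N) hqSylow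
  obtain ⟨W, _, hW, hinv⟩ := exists_isMulCommutative_of_sylow_mem_fixedPoints hrN hR
  exact isCyclic_of_fixedPointFree_of_isMulCommutative W hW hinv fun g hg v _ ↦ hfix g hg v

theorem isCyclic_of_fixedPointFree {A N : Type*} [CommGroup A] [Finite A] [Group N] [Finite N]
    [Nontrivial N] [MulDistribMulAction A N]
    (hfix : ∀ g : A, g ≠ 1 → ∀ v : N, g • v = v → v = 1) : IsCyclic A := by
  have : IsZGroup A := ⟨fun q hq Q ↦
    have : Fact q.Prime := ⟨hq⟩
    isCyclic_of_isPGroup_of_fixedPointFree (N := N) Q.2 fun g hg v hv ↦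
      hfix g (by simpa using hg) v hv⟩
  infer_instance

end FrobeniusComplement

section Anticentral

variable {G : Type*} [Group G]

open scoped commutatorElement

theorem commutatorElement_mem_commutator (a b : G) : ⁅a, b⁆ ∈ commutator G :=
  Subgroup.commutator_mem_commutator (Subgroup.mem_top a) (Subgroup.mem_top b)

theorem exists_conj_eq_mul_of_disjoint_centralizer {D : Subgroup G} [D.Normal] [Finite D] {u : G}
    (hu : Disjoint (Subgroup.centralizer {u}) D) {e : G} (he : e ∈ D) :
    ∃ d ∈ D, d * u * d⁻¹ = u * e := by
  have hmem (d : D) : u⁻¹ * (d * u * (d : G)⁻¹) ∈ D := by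
    have := D.mul_mem (Subgroup.Normal.conj_mem ‹_› (d : G) d.2 u⁻¹) (D.inv_mem d.2)
    simpa [mul_assoc] using this
  let f : D → D := fun d ↦ ⟨u⁻¹ * (d * u * (d : G)⁻¹), hmem d⟩
  have hf : Function.Injective f := fun d d' h ↦ by
    have hconj : (d : G) * u * (d : G)⁻¹ = d' * u * (d' : G)⁻¹ :=
      mul_left_cancel (congrArg Subtype.val h)
    have hcent : (d' : G)⁻¹ * d ∈ Subgroup.centralizer {u} := by
      rw [Subgroup.mem_centralizer_singleton_iff]
      calc (d' : G)⁻¹ * d * u = (d' : G)⁻¹ * (d * u * (d : G)⁻¹) * d := by group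
        _ = u * ((d' : G)⁻¹ * d) := by rw [hconj]; group
    exact Subtype.ext (inv_mul_eq_one.1 <|
      Subgroup.disjoint_def.1 hu hcent (D.mul_mem (D.inv_mem d'.2) d.2)).symm
  obtain ⟨d, hd⟩ := Finite.surjective_of_injective hf ⟨e, he⟩
  exact ⟨d, d.2, inv_mul_eq_iff_eq_mul.1 congr(($hd : G))⟩

theorem IsAnticentral.of_disjoint_centralizer [Finite (commutator G)] {u : G}
    (hu : Disjoint (Subgroup.centralizer {u}) (commutator G)) : IsAnticentral u := fun _ he ↦ by
  obtain ⟨d, -, hd⟩ := exists_conj_eq_mul_of_disjoint_centralizer hu he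
  exact isConj_iff.2 ⟨d, hd⟩

theorem IsAnticentral.disjoint_centralizer {z : G} (hz : IsAnticentral z) (hfin : IsOfFinOrder z)
    (hcop : (orderOf z).Coprime (Nat.card (commutator G))) :
    Disjoint (Subgroup.centralizer {z}) (commutator G) := by
  refine Subgroup.disjoint_def.2 fun {d} hdz hd ↦ ?_
  obtain ⟨c, hc⟩ := isConj_iff.1 (hz d hd)
  have hconj : orderOf (z * d) = orderOf z := by
    rw [← hc, ← MulAut.conj_apply, MulEquiv.orderOf_eq]
  have hcomm : Commute z d := (Subgroup.mem_centralizer_singleton_iff.1 hdz).symm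
  rw [hcomm.orderOf_mul_eq_mul_orderOf_of_coprime
    (hcop.coprime_dvd_right (Subgroup.orderOf_dvd_natCard _ hd))] at hconj
  exact orderOf_eq_one_iff.1 <| (mul_eq_left₀ hfin.orderOf_pos.ne').1 hconj

theorem IsAnticentral.mul_mem {u d : G} (hu : IsAnticentral u) (hd : d ∈ commutator G) :
    IsAnticentral (u * d) := fun e he ↦ by
  rw [mul_assoc]
  exact (hu d hd).symm.trans (hu _ ((commutator G).mul_mem hd he))

theorem not_dvd_card_commutator_of_forall_isAnticentral [Finite (commutator G)] {q : ℕ}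
    (hq : q.Prime) (h : ∀ x : G, orderOf x = q → IsAnticentral x) :
    ¬ q ∣ Nat.card (commutator G) := by
  intro hdvd
  have : Fact q.Prime := ⟨hq⟩
  obtain ⟨x, hx⟩ := exists_prime_orderOf_dvd_card' q hdvd
  rw [← Subgroup.orderOf_coe] at hx
  have hx1 : (x : G) = 1 := by simpa using h x hx _ (inv_mem x.2)
  rw [hx1, orderOf_one] at hx
  exact hq.one_lt.ne hx

theorem isMulCommutative_of_disjoint_commutator {K : Subgroup G}
    (hK : Disjoint K (commutator G)) : IsMulCommutative K :=
  ⟨⟨fun a b ↦ commutatorElement_eq_one_iff_mul_comm.1 <| Subtype.ext <|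
    Subgroup.disjoint_def.1 hK ⁅a, b⁆.2 (commutatorElement_mem_commutator (a : G) b)⟩⟩

theorem le_commutator_of_disjoint_centralizer {A D H : Subgroup G} [D.Normal] [Finite D]
    (hDH : D ≤ H) {y : G} (hy : y ∈ A) (hfix : Disjoint (Subgroup.centralizer {y}) D) :
    D ≤ ⁅H, A⁆ := fun e he ↦ by
  obtain ⟨d, hd, hde⟩ := exists_conj_eq_mul_of_disjoint_centralizer hfix
    (Subgroup.Normal.conj_mem ‹_› e he y⁻¹)
  have hcomm : ⁅d, y⁆ = e := by
    rw [commutatorElement_def, hde]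
    group
  exact hcomm ▸ Subgroup.commutator_mem_commutator (hDH hd) hy

theorem centralizer_sup_commutator_eq_top [Finite (commutator G)] {y : G}
    (hy : Disjoint (Subgroup.centralizer {y}) (commutator G)) :
    Subgroup.centralizer {y} ⊔ commutator G = ⊤ := by
  refine eq_top_iff.2 fun g _ ↦ ?_
  obtain ⟨d, hd, hdg⟩ := exists_conj_eq_mul_of_disjoint_centralizer hy
    (commutatorElement_mem_commutator y⁻¹ g)
  have hcent : d⁻¹ * g ∈ Subgroup.centralizer {y} := by
    rw [Subgroup.mem_centralizer_singleton_iff]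
    calc d⁻¹ * g * y = d⁻¹ * (y * ⁅y⁻¹, g⁆) * g := by rw [commutatorElement_def]; group
      _ = y * (d⁻¹ * g) := by rw [← hdg]; group
  rw [sup_comm, ← mul_inv_cancel_left d g]
  exact Subgroup.mul_mem_sup hd hcent

theorem centralizer_coe_eq_centralizer_singleton {A : Subgroup G} [IsMulCommutative A] {y : G}
    (hy : y ∈ A) [IsMulCommutative (Subgroup.centralizer {y})] :
    Subgroup.centralizer (A : Set G) = Subgroup.centralizer {y} := by
  refine le_antisymm (Subgroup.centralizer_le <| by simpa using hy) fun c hc ↦ ?_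
  have hAC : A ≤ Subgroup.centralizer {y} := A.le_centralizer.trans <|
    Subgroup.centralizer_le <| by simpa using hy
  exact Subgroup.mem_centralizer_iff.2 fun a ha ↦
    setLike_mul_comm (hAC ha) hc

open scoped IsMulCommutative in
theorem isCyclic_of_forall_disjoint_centralizer {A D : Subgroup G} [IsMulCommutative A] [Finite A]
    [D.Normal] [Finite D] (hD : D ≠ ⊥)
    (hfix : ∀ a ∈ A, a ≠ 1 → Disjoint (Subgroup.centralizer {a}) D) : IsCyclic A := by
  have : Nontrivial D := D.nontrivial_iff_ne_bot.2 hD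
  let : MulDistribMulAction A D :=
    MulDistribMulAction.compHom D ((MulAut.conjNormal (H := D)).comp A.subtype)
  refine isCyclic_of_fixedPointFree (N := D) fun a ha d hd ↦ Subtype.ext ?_
  have hconj : (a : G) * d * (a : G)⁻¹ = d := congrArg Subtype.val hd
  refine Subgroup.disjoint_def.1 (hfix a a.2 (by simpa using ha)) ?_ d.2
  exact Subgroup.mem_centralizer_singleton_iff.2 (mul_inv_eq_iff_eq_mul.1 hconj).symm

theorem disjoint_centralizer_of_forall_prime_orderOf {A D : Subgroup G} [Finite A]
    (h : ∀ a ∈ A, (orderOf a).Prime → Disjoint (Subgroup.centralizer {a}) D) {a : G} (ha : a ∈ A)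
    (ha1 : a ≠ 1) : Disjoint (Subgroup.centralizer {a}) D := by
  have hne : orderOf a ≠ 1 := by simpa using ha1
  have hpos : orderOf a ≠ 0 := by
    rw [← Subgroup.orderOf_mk a ha]
    exact (orderOf_pos _).ne'
  have hprime : (orderOf (a ^ (orderOf a / (orderOf a).minFac))).Prime := by
    rw [orderOf_pow_orderOf_div hpos (Nat.minFac_dvd _)]
    exact Nat.minFac_prime hne
  refine (h _ (A.pow_mem ha _) hprime).mono_left fun c hc ↦ ?_
  rw [Subgroup.mem_centralizer_singleton_iff] at hc ⊢
  exact Commute.pow_right hc _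

end Anticentral

namespace HasFrobeniusStructure

variable {G : Type*} [Group G] [Finite G] {A H : Subgroup G}

theorem of_isComplement' (hG : commutator G ≠ ⊥) (hle : commutator G ≤ H) (hA : A ≠ ⊥)
    (hAH : A.IsComplement' H)
    (hfix : ∀ a ∈ A, a ≠ 1 → Disjoint (Subgroup.centralizer {a}) (commutator G)) :
    HasFrobeniusStructure A H := by
  obtain ⟨y, hy, hy1⟩ := A.bot_or_exists_ne_one.resolve_left hA
  have hyfix := hfix y hy hy1
  have : IsMulCommutative A := isMulCommutative_of_disjoint_commutator (hAH.disjoint.mono_right hle)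
  have : IsMulCommutative (Subgroup.centralizer {y}) :=
    isMulCommutative_of_disjoint_commutator hyfix
  have hD : ⁅H, A⁆ = commutator G := le_antisymm (Subgroup.commutator_mono le_top le_top)
    (le_commutator_of_disjoint_centralizer hle hy hyfix)
  have hC : centralizerIn H A = H ⊓ Subgroup.centralizer {y} := by
    rw [centralizerIn, centralizer_coe_eq_centralizer_singleton hy]
  constructor
  case eq_mul => exact hAH.mul_eq
  case ne_bot => exact hA
  case isCyclic => exact isCyclic_of_forall_disjoint_centralizer hG hfix
  case normal => exact .of_commutator_le G hle
  case eq_CD =>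
    rw [hD, hC, Subgroup.inf_mul_assoc _ _ _ hle, ← Subgroup.mul_normal,
      centralizer_sup_commutator_eq_top hyfix, Subgroup.coe_top, Set.inter_univ]
  case abelian_C => exact fun c hc d hd ↦ setLike_mul_comm (hC ▸ hc).2 (hC ▸ hd).2
  case normal_D => exact hD ▸ inferInstance
  case inf_CD => exact hC ▸ hD ▸ (hyfix.mono_left inf_le_right).eq_bot
  case frobenius =>
    rw [hD]
    refine ⟨by simp [Subgroup.normalizer_eq_top], fun a ha ha1 d hd hd1 h ↦ hd1 ?_⟩
    exact Subgroup.disjoint_def.1 (hfix a ha ha1)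
      (Subgroup.mem_centralizer_singleton_iff.2 (mul_inv_eq_iff_eq_mul.1 h).symm) hd

end HasFrobeniusStructure

theorem exists_hasFrobeniusStructure {G : Type*} [Group G] [Finite G] {H : Subgroup G}
    (hG : commutator G ≠ ⊥) (hle : commutator G ≤ H) (hH : H ≠ ⊤)
    (hcop : (Nat.card H).Coprime H.index)
    (h : ∀ z : G, (orderOf z).Prime → orderOf z ∣ H.index → IsAnticentral z) :
    ∃ A : Subgroup G, Nat.card A = H.index ∧ HasFrobeniusStructure A H := by
  have : H.Normal := .of_commutator_le G hle
  obtain ⟨A, hAH⟩ := Subgroup.exists_left_complement'_of_coprime hcop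
  have hcard : Nat.card A = H.index := hAH.index_eq_card.symm
  have hA : A ≠ ⊥ := by
    rintro rfl
    exact hH <| H.index_eq_one.1 <| by rw [← hcard, Subgroup.card_bot]
  refine ⟨A, hcard, .of_isComplement' hG hle hA hAH fun a ha ha1 ↦ ?_⟩
  refine disjoint_centralizer_of_forall_prime_orderOf (fun z hz hzp ↦ ?_) ha ha1
  have hzH : orderOf z ∣ H.index := hcard ▸ A.orderOf_dvd_natCard hz
  exact (h z hzp hzH).disjoint_centralizer (isOfFinOrder_of_finite z) <|
    (hcop.symm.coprime_dvd_left hzH).coprime_dvd_right (Subgroup.card_dvd_of_le hle)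

theorem pow_notMem_of_coprime_index {G : Type*} [Group G] {H : Subgroup G} [H.Normal] {n : ℕ}
    (hn : H.index.Coprime n) {a : G} (ha : a ∉ H) : a ^ n ∉ H := by
  rw [← QuotientGroup.eq_one_iff] at ha ⊢
  exact fun h ↦ ha <| (Nat.Coprime.pow_left_bijective (G := G ⧸ H) hn).injective <| by simpa using h

namespace HasFrobeniusStructure

variable {G : Type*} [Group G] {A H : Subgroup G}

theorem commutator_eq (h : HasFrobeniusStructure A H) : ⁅H, A⁆ = commutator G := by
  refine le_antisymm (Subgroup.commutator_mono le_top le_top) ?_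
  have := h.normal_D
  have := h.isCyclic
  have hCA : centralizerIn H A ≤ Subgroup.centralizer A := inf_le_right
  have hC : centralizerIn H A ≤ Subgroup.centralizer (centralizerIn H A) :=
    fun c hc ↦ Subgroup.mem_centralizer_iff.2 fun d hd ↦ h.abelian_C d hd c hc
  have hAC : IsMulCommutative (A ⊔ centralizerIn H A : Subgroup G) :=
    Subgroup.le_centralizer_iff_isMulCommutative.1 <| sup_le
      (Subgroup.le_centralizer_iff.1 <| sup_le A.le_centralizer hCA)
      (Subgroup.le_centralizer_iff.1 <| sup_le (Subgroup.le_centralizer_iff.1 hCA) hC)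
  refine Subgroup.Normal.commutator_le_of_self_sup_commutative_eq_top ?_ hAC
  refine eq_top_iff.2 fun g _ ↦ ?_
  obtain ⟨a, ha, k, hk, rfl⟩ : g ∈ (A : Set G) * H := h.eq_mul ▸ Set.mem_univ g
  obtain ⟨c, hc, d, hd, rfl⟩ := h.eq_CD ▸ hk
  rw [sup_comm]
  dsimp only
  rw [← mul_assoc]
  exact Subgroup.mul_mem_sup (Subgroup.mul_mem_sup ha hc) hd

theorem disjoint_centralizer (h : HasFrobeniusStructure A H)
    (hcop : (Nat.card H).Coprime H.index) {a c : G} (ha : a ∈ A) (haH : a ∉ H)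
    (hc : c ∈ centralizerIn H A) : Disjoint (Subgroup.centralizer {a * c}) (commutator G) := by
  have := h.normal
  have hpow : (a * c) ^ Nat.card H = a ^ Nat.card H := by
    have hcH : c ^ Nat.card H = 1 := orderOf_dvd_iff_pow_eq_one.1 (H.orderOf_dvd_natCard hc.1)
    rw [Commute.mul_pow (Subgroup.mem_centralizer_iff.1 hc.2 a ha), hcH, mul_one]
  have hpow1 : a ^ Nat.card H ≠ 1 := fun h1 ↦
    pow_notMem_of_coprime_index hcop.symm haH (h1 ▸ H.one_mem)
  refine Subgroup.disjoint_def.2 fun {d} hcent hd ↦ ?_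
  contrapose! hpow1
  rw [Subgroup.mem_centralizer_singleton_iff] at hcent
  have hcomm : Commute d (a ^ Nat.card H) := hpow ▸ Commute.pow_right hcent _
  by_contra ha1
  exact h.frobenius.2 _ (A.pow_mem ha _) ha1 d (h.commutator_eq ▸ hd) hpow1
    (mul_inv_eq_iff_eq_mul.2 hcomm.eq.symm)

theorem isAnticentral [Finite G] (h : HasFrobeniusStructure A H)
    (hcop : (Nat.card H).Coprime H.index) {z : G} (hz : z ∉ H) : IsAnticentral z := by
  obtain ⟨a, ha, k, hk, rfl⟩ : z ∈ (A : Set G) * H := h.eq_mul ▸ Set.mem_univ z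
  have haH : a ∉ H := fun haH ↦ hz (H.mul_mem haH hk)
  obtain ⟨c, hc, d, hd, rfl⟩ := h.eq_CD ▸ hk
  dsimp only
  rw [← mul_assoc]
  exact (IsAnticentral.of_disjoint_centralizer (h.disjoint_centralizer hcop ha haH hc)).mul_mem
    (h.commutator_eq ▸ hd)

end HasFrobeniusStructure

section Hall

variable {G : Type*} [Group G] {p : ℕ} {H : Subgroup G}

theorem IsSylowSubgroup.coprime_card_index [Finite G] (hp : p.Prime) (hH : IsSylowSubgroup p H) :
    (Nat.card H).Coprime H.index := by
  have : Fact p.Prime := ⟨hp⟩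
  obtain ⟨k, hk⟩ := IsPGroup.iff_card.1 hH.1
  rw [hk]
  exact (hp.coprime_iff_not_dvd.2 hH.2).pow_left k

theorem IsHallPPrimeSubgroup.coprime_card_index (hp : p.Prime) (hH : IsHallPPrimeSubgroup p H) :
    (Nat.card H).Coprime H.index := by
  obtain ⟨hpH, k, hk⟩ := hH
  rw [hk]
  exact ((hp.coprime_iff_not_dvd.2 hpH).pow_left k).symm

variable [Finite G]

theorem exists_isSylowSubgroup_commutator_le (hp : p.Prime)
    (h : ∀ q : ℕ, q.Prime → q ∣ Nat.card (commutator G) → q = p) :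
    ∃ H : Subgroup G, commutator G ≤ H ∧ IsSylowSubgroup p H := by
  have : Fact p.Prime := ⟨hp⟩
  have hG' : IsPGroup p (commutator G) :=
    .of_card <| Nat.eq_prime_pow_of_unique_prime_dvd Nat.card_pos.ne' (h _)
  obtain ⟨P, hP⟩ := hG'.exists_le_sylow
  exact ⟨P, hP, P.2, P.not_dvd_index⟩

theorem exists_isHallPPrimeSubgroup_commutator_le (hp : p.Prime)
    (h : ¬ p ∣ Nat.card (commutator G)) :
    ∃ H : Subgroup G, commutator G ≤ H ∧ IsHallPPrimeSubgroup p H := by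
  have : Fact p.Prime := ⟨hp⟩
  set N := Nat.card (Abelianization G)
  have hN : N ≠ 0 := Nat.card_pos.ne'
  let f : G →* Abelianization G := (powMonoidHom (ordCompl[p] N)).comp Abelianization.of
  refine ⟨f.ker, Abelianization.commutator_subset_ker f, fun hdvd ↦ h ?_, ?_⟩
  · obtain ⟨x, hx⟩ := exists_prime_orderOf_dvd_card' p hdvd
    have hxN : orderOf (Abelianization.of (x : G)) ∣ ordCompl[p] N :=
      orderOf_dvd_of_pow_eq_one x.2
    have hxp : orderOf (Abelianization.of (x : G)) ∣ p := by
      rw [← hx, ← Subgroup.orderOf_coe]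
      exact orderOf_map_dvd _ _
    have hx1 : Abelianization.of (x : G) = 1 := orderOf_eq_one_iff.1 <|
      Nat.Coprime.eq_one_of_dvd ((Nat.coprime_ordCompl hp hN).coprime_dvd_left hxp) hxN
    rw [← hx, ← Subgroup.orderOf_coe]
    exact Subgroup.orderOf_dvd_natCard _ ((QuotientGroup.eq_one_iff _).1 hx1)
  · rw [Subgroup.index_ker]
    refine IsPGroup.iff_card.1 ?_
    rintro ⟨_, g, rfl⟩
    refine ⟨N.factorization p, Subtype.ext ?_⟩
    change (Abelianization.of g ^ ordCompl[p] N) ^ ordProj[p] N = 1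
    rw [← pow_mul, mul_comm, Nat.ordProj_mul_ordCompl_eq_self]
    exact pow_card_eq_one'

theorem exists_isHallPPrimeSubgroup_hasFrobeniusStructure (hp : p.Prime) (hpG : p ∣ Nat.card G)
    (hG : commutator G ≠ ⊥) (h : ∀ x : G, orderOf x = p → IsAnticentral x) :
    ∃ A H : Subgroup G, IsHallPPrimeSubgroup p H ∧ HasFrobeniusStructure A H := by
  obtain ⟨H, hle, hH⟩ := exists_isHallPPrimeSubgroup_commutator_le hp
    (not_dvd_card_commutator_of_forall_isAnticentral hp h)
  have hHtop : H ≠ ⊤ := by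
    rintro rfl
    exact hH.1 (by rwa [Subgroup.card_top])
  obtain ⟨A, -, hA⟩ := exists_hasFrobeniusStructure hG hle hHtop (hH.coprime_card_index hp)
    fun z hz hzH ↦ h z <| by
      obtain ⟨k, hk⟩ := hH.2
      exact (Nat.prime_dvd_prime_iff_eq hz hp).1 (hz.dvd_of_dvd_pow (hk ▸ hzH))
  exact ⟨A, H, hH, hA⟩

theorem exists_isSylowSubgroup_hasFrobeniusStructure (hp : p.Prime) (hpG : ¬ IsPGroup p G)
    (hG : commutator G ≠ ⊥) (h : ∀ y : G, (orderOf y).Prime → orderOf y ≠ p → IsAnticentral y) :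
    ∃ A H : Subgroup G, IsPPrimeGroup p A ∧ IsSylowSubgroup p H ∧ HasFrobeniusStructure A H := by
  obtain ⟨H, hle, hH⟩ := exists_isSylowSubgroup_commutator_le (G := G) hp fun q hq hqG ↦ by
    by_contra hqp
    exact not_dvd_card_commutator_of_forall_isAnticentral hq
      (fun y hy ↦ h y (hy ▸ hq) (hy ▸ hqp)) hqG
  have hHtop : H ≠ ⊤ := by
    rintro rfl
    exact hpG (hH.1.of_equiv Subgroup.topEquiv)
  obtain ⟨A, hAH, hA⟩ := exists_hasFrobeniusStructure hG hle hHtop (hH.coprime_card_index hp)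
    fun z hz hzH ↦ h z hz fun hzp ↦ hH.2 (hzp ▸ hzH)
  exact ⟨A, H, by rw [IsPPrimeGroup, hAH]; exact hH.2, hH, hA⟩

end Hall

section Multiplicativity

variable {G : Type*} [Group G] {p : ℕ} {x y : G}

theorem IsPElement.dvd_orderOf (hx : IsPElement p x) (hx1 : x ≠ 1) : p ∣ orderOf x := by
  obtain ⟨k, hk⟩ := hx
  rw [hk]
  refine dvd_pow_self p ?_
  rintro rfl
  exact hx1 (orderOf_eq_one_iff.1 hk)

theorem IsPElement.coprime_orderOf (hp : p.Prime) (hx : IsPElement p x)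
    (hy : IsPPrimeElement p y) : (orderOf x).Coprime (orderOf y) := by
  obtain ⟨k, hk⟩ := hx
  rw [hk]
  exact (hp.coprime_iff_not_dvd.2 hy).pow_left k

theorem dvd_orderOf_of_isPGroup (hp : p.Prime) {H : Subgroup G} (hH : IsPGroup p H) (hx : x ∈ H)
    (hx1 : x ≠ 1) : p ∣ orderOf x := by
  have : Fact p.Prime := ⟨hp⟩
  obtain ⟨k, hk⟩ := IsPGroup.iff_orderOf.1 hH ⟨x, hx⟩
  exact IsPElement.dvd_orderOf ⟨k, by rwa [Subgroup.orderOf_mk] at hk⟩ hx1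

theorem notMem_of_isPGroup_of_coprime_orderOf (hp : p.Prime) {H : Subgroup G} (hH : IsPGroup p H)
    (hx1 : x ≠ 1) (hy1 : y ≠ 1) (hxy : (orderOf x).Coprime (orderOf y)) (hx : x ∈ H) : y ∉ H :=
  fun hy ↦ Nat.not_coprime_of_dvd_of_dvd hp.one_lt (dvd_orderOf_of_isPGroup hp hH hx hx1)
    (dvd_orderOf_of_isPGroup hp hH hy hy1) hxy

theorem mem_of_mul_mem_of_coprime_orderOf {H : Subgroup G} [H.Normal]
    (hxy : (orderOf x).Coprime (orderOf y)) (hmem : x * y ∈ H) : x ∈ H := by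
  rw [← QuotientGroup.eq_one_iff, QuotientGroup.mk_mul] at hmem
  rw [← QuotientGroup.eq_one_iff, ← orderOf_eq_one_iff]
  refine Nat.Coprime.eq_one_of_dvd (hxy.coprime_dvd_left ?_) ?_
  · exact orderOf_map_dvd (QuotientGroup.mk' H) x
  · rw [eq_inv_of_mul_eq_one_left hmem, orderOf_inv]
    exact orderOf_map_dvd (QuotientGroup.mk' H) y

theorem IsPMultiplicative.of_isPGroup (hp : p.Prime) (hG : IsPGroup p G) : IsPMultiplicative p G :=
  fun _ y _ hy1 _ hy _ _ _ ↦
    absurd (dvd_orderOf_of_isPGroup hp (hG.to_subgroup ⊤) (Subgroup.mem_top y) hy1) hy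

theorem IsPMultiplicative.of_isPPrimeGroup (hG : IsPPrimeGroup p G) : IsPMultiplicative p G :=
  fun x _ hx1 _ hx _ _ _ _ ↦ absurd ((hx.dvd_orderOf hx1).trans (orderOf_dvd_natCard x)) hG

/-- Every irreducible character of `G` is multiplicative on the products of two nonidentity elements
of coprime prime power orders. -/
def IsCoprimeMultiplicative (G : Type*) [Group G] : Prop :=
  ∀ x y : G, x ≠ 1 → y ≠ 1 → HasPrimePowerOrder x → HasPrimePowerOrder y →
    (orderOf x).Coprime (orderOf y) → ∀ χ ∈ IrrChar G, χ (x * y) = χ x * χ y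

theorem IsCoprimeMultiplicative.isPMultiplicative (h : IsCoprimeMultiplicative G) (hp : p.Prime) :
    IsPMultiplicative p G := fun x y hx1 hy1 hx hy hyq ↦
  h x y hx1 hy1 ⟨p, hx.imp fun _ hk ↦ ⟨hp, hk⟩⟩ hyq (hx.coprime_orderOf hp hy)

variable [Finite G] {A H : Subgroup G}

theorem HasFrobeniusStructure.irrChar_mul (h : HasFrobeniusStructure A H)
    (hcop : (Nat.card H).Coprime H.index) (hxy : (orderOf x).Coprime (orderOf y))
    (hmem : x ∈ H → y ∉ H) {χ : G → ℂ} (hχ : χ ∈ IrrChar G) : χ (x * y) = χ x * χ y := by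
  have := h.normal
  by_cases h1 : χ 1 = 1
  · exact IrrChar.mul_of_apply_one_eq_one hχ h1 x y
  have hzero {z : G} (hz : z ∉ H) : χ z = 0 :=
    IrrChar.isAnticentral_iff.1 (h.isAnticentral hcop hz) χ hχ h1
  have hxyH : x * y ∉ H := fun hxyH ↦ by
    have hx : x ∈ H := mem_of_mul_mem_of_coprime_orderOf hxy hxyH
    exact hmem hx ((H.mul_mem_cancel_left hx).1 hxyH)
  by_cases hx : x ∈ H
  · rw [hzero hxyH, hzero (hmem hx), mul_zero]
  · rw [hzero hxyH, hzero hx, zero_mul]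

theorem IsSylowSubgroup.irrChar_mul (hp : p.Prime) (hH : IsSylowSubgroup p H)
    (hA : HasFrobeniusStructure A H) (hx1 : x ≠ 1) (hy1 : y ≠ 1)
    (hxy : (orderOf x).Coprime (orderOf y)) {χ : G → ℂ} (hχ : χ ∈ IrrChar G) :
    χ (x * y) = χ x * χ y :=
  hA.irrChar_mul (hH.coprime_card_index hp) hxy
    (notMem_of_isPGroup_of_coprime_orderOf hp hH.1 hx1 hy1 hxy) hχ

namespace IsPMultiplicative

theorem exists_hasFrobeniusStructure (h : IsPMultiplicative p G) (hp : p.Prime)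
    (hpG : p ∣ Nat.card G) (hpG' : ¬ IsPGroup p G) (hG : ¬ IsMulCommutative G) :
    (∃ A H : Subgroup G, IsHallPPrimeSubgroup p H ∧ HasFrobeniusStructure A H) ∨
      ∃ A H : Subgroup G, IsPPrimeGroup p A ∧ IsSylowSubgroup p H ∧
        HasFrobeniusStructure A H := by
  rw [← commutator_eq_bot_iff] at hG
  have hne {z : G} (hz : (orderOf z).Prime) : z ≠ 1 := by
    rintro rfl
    exact hz.ne_one orderOf_one
  refine (h.forall_isAnticentral_or_forall_isAnticentral hp hpG).imp (fun hanti ↦ ?_)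
    fun hanti ↦ ?_
  · exact exists_isHallPPrimeSubgroup_hasFrobeniusStructure hp hpG hG fun x hx ↦
      hanti x (hne (hx ▸ hp)) ⟨1, by rw [hx, pow_one]⟩
  · exact exists_isSylowSubgroup_hasFrobeniusStructure hp hpG' hG fun y hy hyp ↦
      hanti y (hne hy) (fun hpy ↦ hyp ((Nat.prime_dvd_prime_iff_eq hp hy).1 hpy).symm)
        ⟨_, 1, hy, (pow_one _).symm⟩

theorem of_hasFrobeniusStructure (hp : p.Prime) (hA : HasFrobeniusStructure A H)
    (hH : IsSylowSubgroup p H ∨ IsHallPPrimeSubgroup p H) : IsPMultiplicative p G := by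
  intro x y hx1 hy1 hx hy _ χ hχ
  have hxy := hx.coprime_orderOf hp hy
  rcases hH with hH | hH
  · exact hH.irrChar_mul hp hA hx1 hy1 hxy hχ
  · refine hA.irrChar_mul (hH.coprime_card_index hp) hxy (fun hxH ↦ ?_) hχ
    exact absurd ((hx.dvd_orderOf hx1).trans (H.orderOf_dvd_natCard hxH)) hH.1

end IsPMultiplicative

theorem IsCoprimeMultiplicative.exists_hasFrobeniusStructure (h : IsCoprimeMultiplicative G)
    (hpG : ¬ ∃ q : ℕ, q.Prime ∧ IsPGroup q G) (hG : ¬ IsMulCommutative G) :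
    ∃ q : ℕ, q.Prime ∧ ∃ A P : Subgroup G, IsPPrimeGroup q A ∧ IsSylowSubgroup q P ∧
      HasFrobeniusStructure A P := by
  obtain ⟨p, hp, hpG'⟩ := Nat.exists_prime_and_dvd <|
    mt Subgroup.card_eq_one.1 <| mt (commutator_eq_bot_iff G).1 hG
  have hdvd : p ∣ Nat.card G := hpG'.trans (commutator G).card_subgroup_dvd_card
  refine ⟨p, hp, ((h.isPMultiplicative hp).exists_hasFrobeniusStructure hp hdvd
    (fun hG ↦ hpG ⟨p, hp, hG⟩) hG).resolve_left ?_⟩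
  rintro ⟨A, H, hH, hA⟩
  have := hA.normal
  have hle : commutator G ≤ H := hA.commutator_eq ▸ Subgroup.commutator_le_left H A
  exact hH.1 (hpG'.trans (Subgroup.card_dvd_of_le hle))

end Multiplicativity

theorem theorem3p2 (G : Type*) [Group G] [Finite G] :
    (∀ p : ℕ, p.Prime →
      ((∀ x y : G, x ≠ 1 → y ≠ 1 → IsPElement p x → IsPPrimeElement p y → HasPrimePowerOrder y →
          ∀ χ ∈ IrrChar G, χ (x * y) = χ x * χ y) ↔
        (IsPGroup p G ∨ IsPPrimeGroup p G ∨ (∀ a b : G, a * b = b * a) ∨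
          ∃ A H : Subgroup G, (IsSylowSubgroup p H ∨ IsHallPPrimeSubgroup p H) ∧
            HasFrobeniusStructure A H))) ∧
    ((∀ x y : G, x ≠ 1 → y ≠ 1 → HasPrimePowerOrder x → HasPrimePowerOrder y →
        Nat.Coprime (orderOf x) (orderOf y) →
          ∀ χ ∈ IrrChar G, χ (x * y) = χ x * χ y) ↔
      ((∃ q : ℕ, q.Prime ∧ IsPGroup q G) ∨ (∀ a b : G, a * b = b * a) ∨
        ∃ q : ℕ, q.Prime ∧ ∃ A P : Subgroup G, IsPPrimeGroup q A ∧ IsSylowSubgroup q P ∧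
          HasFrobeniusStructure A P)) := by
  change (∀ p : ℕ, p.Prime → (IsPMultiplicative p G ↔ _)) ∧ (IsCoprimeMultiplicative G ↔ _)
  simp only [← isMulCommutative_iff]
  refine ⟨fun p hp ↦ ⟨fun h ↦ ?_, ?_⟩, ⟨fun h ↦ ?_, ?_⟩⟩
  · by_contra! ⟨hpG, hpG', hG, hne⟩
    rcases h.exists_hasFrobeniusStructure hp (not_not.1 hpG') hpG hG with
      ⟨A, H, hH, hA⟩ | ⟨A, H, -, hH, hA⟩
    exacts [hne A H (.inr hH) hA, hne A H (.inl hH) hA]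
  · rintro (hG | hG | hG | ⟨A, H, hH, hA⟩)
    · exact .of_isPGroup hp hG
    · exact .of_isPPrimeGroup hG
    · exact fun x y _ _ _ _ _ χ hχ ↦ IrrChar.mul_of_isMulCommutative hχ x y
    · exact .of_hasFrobeniusStructure hp hA hH
  · rw [or_iff_not_imp_left, or_iff_not_imp_left]
    exact fun hpG hG ↦ h.exists_hasFrobeniusStructure hpG hG
  · rintro (⟨q, hq, hG⟩ | hG | ⟨q, hq, A, P, -, hP, hA⟩) x y hx1 hy1 - - hxy χ hχ
    · exact absurd (Subgroup.mem_top y) <| notMem_of_isPGroup_of_coprime_orderOf hq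
        (hG.to_subgroup ⊤) hx1 hy1 hxy (Subgroup.mem_top x)
    · exact IrrChar.mul_of_isMulCommutative hχ x y
    · exact hP.irrChar_mul hq hA hx1 hy1 hxy hχ
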